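/- Conventions. A represented space is a set $X$ with a partial surjection from $\mathbb{N}^{\mathbb{N}}$ onto $X$; the preimages of $x$ are its names. A partial multivalued function $f :\subseteq X \rightrightarrows Y$ assigns to $x \in X$ a set $f(x) \subseteq Y$, and $\operatorname{dom}(f) = \{x \mid f(x) \neq \emptyset\}$. A partial function $G$ on $\mathbb{N}^{\mathbb{N}}$ realizes $f$ if it maps each name of each $x \in \operatorname{dom}(f)$ to a name of some $y \in f(x)$. We write $f \leq_{\mathrm W} g$ ($f$ is Weihrauch reducible to $g$) if there are computable partial functions $H, K$ on $\mathbb{N}^{\mathbb{N}}$ such that $p \mapsto K\langle p, G(H(p))\rangle$ realizes $f$ whenever $G$ realizes $g$. The product is $(f \times g)(x,z) = f(x) \times g(z)$. A real number $x$ is named by sequences $(q_n)_n$ of rationals with $|q_n - x| < 2^{-n}$, and $[0,1]$ is a subspace of $\mathbb{R}$. A closed subset of $[0,1]$ is named by sequences of open rational intervals whose union covers exactly the complement of the set in $[0,1]$; a subset of $\{0,\ldots,k-1\}$ is named by enumerations of its complement; a number $i \in \{0,\ldots,k-1\}$ is named by sequences with first entry $i$. A polynomial in $\mathbb{R}[X]$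 is named by an upper bound $d$ on its degree together with names of its coefficients of $X^0, \ldots, X^d$. Define: - $\mathrm{AoUC}_{[0,1]}$ (all-or-unique choice): given a closed set $A \subseteq [0,1]$ that is either $[0,1]$ or a singleton, return a point of $A$; - $\mathrm{C}_2$ (also called $\mathrm{LLPO}$): given a nonempty set $A \subseteq \{0,1\}$, return an element of $A$; - $\mathrm{BRoot}$: given $P \in \mathbb{R}[X]$, return a root of $P$ in $[0,1]$ if there is one, and an arbitrary point of $[0,1]$ otherwise. Proposition. $\mathrm{AoUC}_{[0,1]} \times \mathrm{C}_2 \not\leq_{\mathrm W} \mathrm{BRoot}$. -/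

import Mathlib

namespace Weihrauch

/-- Baire space, whose points serve as names of mathematical objects. -/
abbrev Baire : Type := ℕ → ℕ

/-- The finite prefix of length `n` of a point of Baire space. -/
def Baire.take (p : Baire) (n : ℕ) : List ℕ := (List.range n).map p

/-- The pairing `⟨p, q⟩` of Baire space: `p` on the even and `q` on the odd positions. -/
def Baire.pair (p q : Baire) : Baire := fun n => if n % 2 = 0 then p (n / 2) else q (n / 2)

/-- `q` is the infinite output produced on the infinite input `p` by the word function `h`:
every `h (p.take n)` is a prefix of `q`, and these prefixes become arbitrarily long. -/
def IsOutput (h : List ℕ → List ℕ) (p q : Baire) : Prop :=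
  (∀ n, h (p.take n) = q.take (h (p.take n)).length) ∧ ∀ m, ∃ n, m ≤ (h (p.take n)).length

/-- Computability of a partial function on Baire space (type-2 computability): a Turing computable
word function, monotone for the prefix order, produces ever longer prefixes of the output from ever
longer prefixes of the input, for all inputs in the domain. -/
def IsComputable (F : Baire →. Baire) : Prop :=
  ∃ h : List ℕ → List ℕ, Computable h ∧ (∀ u v, u <+: v → h u <+: h v) ∧
    ∀ p q, q ∈ F p → IsOutput h p q

/-- A represented space: each point has at least one name in Baire space, and a name
determines the point (so names form a surjective partial function from Baire space). -/
class RepresentedSpace (X : Type*) where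
  IsName : Baire → X → Prop
  unique : ∀ {p x y}, IsName p x → IsName p y → x = y
  surjective : ∀ x, ∃ p, IsName p x

open RepresentedSpace (IsName)

/-- A partial multivalued function from `X` to `Y`, as the map that sends `x` to the set of its
values; `x` is in the domain if this set is nonempty. -/
def MultiFun (X Y : Type*) : Type _ := X → Set Y

/-- The domain of a partial multivalued function. -/
def MultiFun.dom {X Y : Type*} (f : MultiFun X Y) : Set X := {x | (f x).Nonempty}

/-- The parallel product `f × g`. -/
def MultiFun.prod {X Y Z W : Type*} (f : MultiFun X Y) (g : MultiFun Z W) :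
    MultiFun (X × Z) (Y × W) := fun x => f x.1 ×ˢ g x.2

/-- `G` realizes `f`: it maps each name of each point of the domain to a name of some value. -/
def IsRealizer {X Y : Type*} [RepresentedSpace X] [RepresentedSpace Y]
    (G : Baire →. Baire) (f : MultiFun X Y) : Prop :=
  ∀ p x, IsName p x → x ∈ f.dom → ∃ q ∈ G p, ∃ y ∈ f x, IsName q y

/-- Weihrauch reducibility `f ≤_W g`: there are computable `H`, `K` such that
`p ↦ K ⟨p, G (H p)⟩` realizes `f` whenever `G` realizes `g`. -/
def Reducible {X Y Z W : Type*} [RepresentedSpace X] [RepresentedSpace Y] [RepresentedSpace Z]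
    [RepresentedSpace W] (f : MultiFun X Y) (g : MultiFun Z W) : Prop :=
  ∃ H K : Baire →. Baire, IsComputable H ∧ IsComputable K ∧
    ∀ G : Baire →. Baire, IsRealizer G g →
      IsRealizer (fun p => (H p).bind fun a => (G a).bind fun b => K (Baire.pair p b)) f

theorem Baire.pair_even (p q : Baire) (n : ℕ) : Baire.pair p q (2 * n) = p n := by
  simp [Baire.pair]

theorem Baire.pair_odd (p q : Baire) (n : ℕ) : Baire.pair p q (2 * n + 1) = q n := by
  have h1 : (2 * n + 1) % 2 = 1 := by omega
  have h2 : (2 * n + 1) / 2 = n := by omega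
  simp [Baire.pair, h1, h2]

/-- The product of represented spaces. -/
instance {X Y : Type*} [RepresentedSpace X] [RepresentedSpace Y] : RepresentedSpace (X × Y) where
  IsName p z := IsName (fun n => p (2 * n)) z.1 ∧ IsName (fun n => p (2 * n + 1)) z.2
  unique h h' := Prod.ext (RepresentedSpace.unique h.1 h'.1) (RepresentedSpace.unique h.2 h'.2)
  surjective z := by
    obtain ⟨p, hp⟩ := RepresentedSpace.surjective z.1
    obtain ⟨q, hq⟩ := RepresentedSpace.surjective z.2
    refine ⟨Baire.pair p q, ?_, ?_⟩
    · simpa only [Baire.pair_even] using hp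
    · simpa only [Baire.pair_odd] using hq

/-- The finite discrete space `{0, …, k - 1}`. -/
instance (k : ℕ) : RepresentedSpace (Fin k) where
  IsName p i := p 0 = i
  unique h h' := Fin.ext (h.symm.trans h')
  surjective i := ⟨fun _ => i, rfl⟩

/-- A standard numbering of the rational numbers: `⟨⟨a, b⟩, c⟩ ↦ (a - b) / (c + 1)`. -/
def ratOfNat (n : ℕ) : ℚ :=
  ((n.unpair.1.unpair.1 : ℚ) - n.unpair.1.unpair.2) / (n.unpair.2 + 1)

theorem ratOfNat_surjective : Function.Surjective ratOfNat := by
  intro r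
  refine ⟨Nat.pair (Nat.pair r.num.toNat (-r.num).toNat) (r.den - 1), ?_⟩
  have h1 : ((r.num.toNat : ℚ) - ((-r.num).toNat : ℚ)) = r.num := by
    exact_mod_cast Int.toNat_sub_toNat_neg r.num
  have h2 : (((r.den - 1 : ℕ) : ℚ) + 1) = r.den := by
    exact_mod_cast Nat.sub_add_cancel r.pos
  simp only [ratOfNat, Nat.unpair_pair, h1, h2]
  exact r.num_div_den

/-- The real numbers: `p` names `x` if the `n`-th rational number listed by `p` is at distance
less than `2⁻ⁿ` from `x`. -/
instance : RepresentedSpace ℝ where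
  IsName p x := ∀ n, |(ratOfNat (p n) : ℝ) - x| < (2 : ℝ)⁻¹ ^ n
  unique {p x y} h h' := by
    refine eq_of_abs_sub_le_all fun ε hε => ?_
    obtain ⟨n, hn⟩ := exists_pow_lt_of_lt_one (half_pos hε) (by norm_num : (2 : ℝ)⁻¹ < 1)
    have h1 := abs_lt.1 (h n)
    have h2 := abs_lt.1 (h' n)
    rw [abs_le]
    constructor <;> linarith
  surjective x := by
    have h : ∀ n : ℕ, ∃ m, |(ratOfNat m : ℝ) - x| < (2 : ℝ)⁻¹ ^ n := by
      intro n
      have hpos : (0 : ℝ) < (2 : ℝ)⁻¹ ^ n := by positivity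
      obtain ⟨r, h1, h2⟩ := exists_rat_btwn (show x < x + (2 : ℝ)⁻¹ ^ n by linarith)
      obtain ⟨m, rfl⟩ := ratOfNat_surjective r
      refine ⟨m, ?_⟩
      rw [abs_lt]
      constructor <;> linarith
    choose p hp using h
    exact ⟨p, hp⟩

/-- The unit interval `[0, 1]`, as a subspace of the real numbers. -/
instance : RepresentedSpace unitInterval where
  IsName p x := IsName p (x : ℝ)
  unique h h' := Subtype.ext (RepresentedSpace.unique h h')
  surjective x := RepresentedSpace.surjective (x : ℝ)

/-- The open rational interval with code `m`, intersected with `[0, 1]`. -/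
def ratInterval (m : ℕ) : Set unitInterval :=
  {x | (ratOfNat m.unpair.1 : ℝ) < x ∧ (x : ℝ) < ratOfNat m.unpair.2}

/-- The space `𝒜([0, 1])` of closed subsets of `[0, 1]` with negative information:
a name lists open rational intervals whose union is the complement of the set. -/
instance : RepresentedSpace (TopologicalSpace.Closeds unitInterval) where
  IsName p A := (A : Set unitInterval)ᶜ = ⋃ n, ratInterval (p n)
  unique h h' := TopologicalSpace.Closeds.ext (compl_injective (h.trans h'.symm))
  surjective A := by
    classical
    refine ⟨fun n => if ratInterval n ⊆ (A : Set unitInterval)ᶜ then n else 0, ?_⟩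
    ext x
    simp only [Set.mem_iUnion]
    constructor
    · intro hx
      obtain ⟨ε, hε, hball⟩ := Metric.isOpen_iff.1 A.isClosed.isOpen_compl x hx
      obtain ⟨a, ha1, ha2⟩ := exists_rat_btwn (show (x : ℝ) - ε < x by linarith)
      obtain ⟨b, hb1, hb2⟩ := exists_rat_btwn (show (x : ℝ) < x + ε by linarith)
      obtain ⟨i, rfl⟩ := ratOfNat_surjective a
      obtain ⟨j, rfl⟩ := ratOfNat_surjective b
      have hsub : ratInterval (Nat.pair i j) ⊆ (A : Set unitInterval)ᶜ := by
        rintro y ⟨hy1, hy2⟩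
        simp only [Nat.unpair_pair] at hy1 hy2
        apply hball
        rw [Metric.mem_ball, Subtype.dist_eq, Real.dist_eq, abs_lt]
        constructor <;> linarith
      refine ⟨Nat.pair i j, ?_⟩
      rw [if_pos hsub]
      simpa [ratInterval] using ⟨ha2, hb1⟩
    · rintro ⟨n, hn⟩
      split_ifs at hn with h
      · exact h hn
      · exact absurd (hn.1.trans hn.2) (by simp)

/-- The space `𝒜({0, …, k - 1})` of (closed) subsets of `{0, …, k - 1}` with negative information:
a name enumerates the complement, where an entry `i + 1` removes `i` and other entries (such
as `0`) remove nothing. -/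
instance (k : ℕ) : RepresentedSpace (TopologicalSpace.Closeds (Fin k)) where
  IsName p A := (A : Set (Fin k))ᶜ = {i : Fin k | ∃ n, p n = (i : ℕ) + 1}
  unique h h' := TopologicalSpace.Closeds.ext (compl_injective (h.trans h'.symm))
  surjective A := by
    classical
    refine ⟨fun n => if ∃ i : Fin k, i ∉ A ∧ n = (i : ℕ) + 1 then n else 0, ?_⟩
    ext i
    simp only [Set.mem_compl_iff, SetLike.mem_coe, Set.mem_ofPred_eq]
    constructor
    · intro hi
      exact ⟨i + 1, if_pos ⟨i, hi, rfl⟩⟩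
    · rintro ⟨n, hn⟩
      split_ifs at hn with h
      obtain ⟨j, hj, hnj⟩ := h
      have : j = i := Fin.ext (by omega)
      exact this ▸ hj

/-- The space `ℝ[X]`: a name gives an upper bound `d` on the degree (in its first entry) and names
of the real coefficients of `X ^ i` for `i ≤ d`. -/
instance : RepresentedSpace (Polynomial ℝ) where
  IsName p P := P.natDegree ≤ p 0 ∧ ∀ i ≤ p 0, IsName (fun k => p (Nat.pair i k + 1)) (P.coeff i)
  unique {p P Q} h h' := by
    ext i
    rcases le_or_gt i (p 0) with hi | hi
    · exact RepresentedSpace.unique (h.2 i hi) (h'.2 i hi)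
    · rw [Polynomial.coeff_eq_zero_of_natDegree_lt (h.1.trans_lt hi),
        Polynomial.coeff_eq_zero_of_natDegree_lt (h'.1.trans_lt hi)]
  surjective P := by
    choose c hc using fun i => RepresentedSpace.surjective (P.coeff i)
    refine ⟨fun n => if n = 0 then P.natDegree else c (n - 1).unpair.1 (n - 1).unpair.2,
      le_of_eq (by simp), fun i _ => ?_⟩
    simpa using hc i

/-- All-or-unique choice `AoUC_[0,1]`: given the closed set `[0, 1]` or a singleton
by negative information, find a point of it. -/
def AoUC : MultiFun (TopologicalSpace.Closeds unitInterval) unitInterval :=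
  fun A => {x | ((A : Set unitInterval) = Set.univ ∨ ∃ y, (A : Set unitInterval) = {y}) ∧ x ∈ A}

/-- Finite closed choice `C_k`: given a nonempty subset of `{0, …, k - 1}` by negative information,
find a point of it. -/
def C (k : ℕ) : MultiFun (TopologicalSpace.Closeds (Fin k)) (Fin k) :=
  fun A => {i | i ∈ A}

/-- `BRoot`: given a real polynomial, find a root in `[0, 1]` if there is one, and any point of
`[0, 1]` otherwise. -/
def BRoot : MultiFun (Polynomial ℝ) unitInterval :=
  fun P => {x | (∃ y : unitInterval, P.IsRoot (y : ℝ)) → P.IsRoot (x : ℝ)}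

end Weihrauch

namespace Weihrauch

open RepresentedSpace (IsName)

/-! The proof uses only the continuity of `H` and `K`. Suppose that on some name of `([0,1], B)` the
map `H` produced a polynomial `P ≠ 0`. Finitely many answers to `P` then suffice (its roots, or one
point if there are none), and `K` turns them into finitely many points of `[0,1]`. Let `y` be
another point. After a long prefix, the set `[0,1]` can still shrink to `{y}`; the new polynomial is
so close to `P` that it has an answer near one of the chosen ones, and there `K` still misses `y`, a
contradiction. So `P = 0` (`reduction_top_eq_zero`, via the stability lemma `exists_finite_BRoot`).

Every point answers the zero polynomial, so one fixed name of `0` serves for all `B`. Then `K` alone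
would solve `C_2` continuously, which fails: its answer can be removed from `B` after it has been
given. -/

/-! ### Continuity and reductions -/

/-- Continuity of computable functions: finitely many output entries depend only on finitely many
input entries. -/
theorem IsComputable.exists_modulus {F : Baire →. Baire} (hF : IsComputable F) {p q : Baire}
    (hq : q ∈ F p) (m : ℕ) :
    ∃ N, ∀ p' q', (∀ n < N, p' n = p n) → q' ∈ F p' → ∀ n < m, q' n = q n := by
  obtain ⟨h, -, -, hout⟩ := hF
  obtain ⟨h1, h2⟩ := hout p q hq
  obtain ⟨N, hN⟩ := h2 m
  refine ⟨N, fun p' q' hpp hq' n hn => ?_⟩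
  have h3 := (hout p' q' hq').1 N
  have htake : p'.take N = p.take N :=
    List.map_congr_left fun n hn => hpp n (List.mem_range.1 hn)
  rw [htake] at h3
  exact List.map_inj_left.1 (h3.symm.trans (h1 N)) n (List.mem_range.2 (hn.trans_le hN))

/-- The data that a reduction to a total multivalued function provides on a single input. -/
theorem exists_name_of_reduction {X Y Z W : Type*} [RepresentedSpace X] [RepresentedSpace Y]
    [RepresentedSpace Z] [RepresentedSpace W] {f : MultiFun X Y} {g : MultiFun Z W}
    (hg : ∀ z, (g z).Nonempty) {H K : Baire →. Baire}
    (hHK : ∀ G : Baire →. Baire, IsRealizer G g →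
      IsRealizer (fun p => (H p).bind fun a => (G a).bind fun b => K (Baire.pair p b)) f)
    {p : Baire} {x : X} (hp : IsName p x) (hx : x ∈ f.dom) :
    ∃ a ∈ H p, ∃ z : Z, IsName a z ∧ ∀ w ∈ g z, ∀ b, IsName b w →
      ∃ c ∈ K (Baire.pair p b), ∃ y ∈ f x, IsName c y := by
  classical
  choose w₀ hw₀ using hg
  choose nm hnm using fun w : W => RepresentedSpace.surjective w
  -- Undefined off the names, so that convergence of the composition shows `a` to be a name.
  let G₀ : Baire →. Baire := fun a => ⟨∃ z : Z, IsName a z, fun h => nm (w₀ h.choose)⟩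
  have hG₀ : IsRealizer G₀ g := by
    intro a z ha _
    have hex : ∃ z : Z, IsName a z := ⟨z, ha⟩
    have hz : hex.choose = z := RepresentedSpace.unique hex.choose_spec ha
    refine ⟨nm (w₀ hex.choose), ⟨hex, rfl⟩, w₀ z, hw₀ z, ?_⟩
    rw [hz]
    exact hnm _
  obtain ⟨c, hc, -⟩ := hHK G₀ hG₀ p x hp hx
  obtain ⟨a, ha, hc⟩ := Part.mem_bind_iff.1 hc
  obtain ⟨b, ⟨⟨z, hz⟩, -⟩, -⟩ := Part.mem_bind_iff.1 hc
  refine ⟨a, ha, z, hz, fun w hw b hb => ?_⟩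
  -- Changing the realizer at `a` alone is harmless, since `a` names only `z`.
  let G : Baire →. Baire := fun a' => if a' = a then Part.some b else G₀ a'
  have hG : IsRealizer G g := by
    intro a' z' ha' hz'
    by_cases h : a' = a
    · subst h
      obtain rfl := RepresentedSpace.unique hz ha'
      exact ⟨b, by simp [G], w, hw, hb⟩
    · simpa only [G, if_neg h] using hG₀ a' z' ha' hz'
  obtain ⟨c, hc, y, hy, hcy⟩ := hHK G hG p x hp hx
  obtain ⟨a', ha', hc⟩ := Part.mem_bind_iff.1 hc
  obtain rfl := Part.mem_unique ha ha'
  obtain ⟨b', hb', hc : c ∈ K (Baire.pair p b')⟩ := Part.mem_bind_iff.1 hc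
  have hbb : b' = b := by simpa [G] using hb'
  rw [hbb] at hc
  exact ⟨c, hc, y, hy, hcy⟩

theorem BRoot_nonempty (P : Polynomial ℝ) : (BRoot P).Nonempty := by
  by_cases h : ∃ y : unitInterval, P.IsRoot (y : ℝ)
  · obtain ⟨y, hy⟩ := h
    exact ⟨y, fun _ => hy⟩
  · exact ⟨0, fun h' => absurd h' h⟩

/-! ### Stability of roots under perturbation -/

/-- Every prefix of a name of `x` extends to a name of each point near `x`. -/
theorem exists_isOpen_name_extension {b : Baire} {x : unitInterval} (hb : IsName b x) (M : ℕ) :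
    ∃ U : Set unitInterval, IsOpen U ∧ x ∈ U ∧
      ∀ y ∈ U, ∃ b' : Baire, IsName b' y ∧ ∀ n < M, b' n = b n := by
  refine ⟨⋂ n ∈ Finset.range M, {y : unitInterval | |(ratOfNat (b n) : ℝ) - y| < (2 : ℝ)⁻¹ ^ n},
    isOpen_biInter_finset fun n _ => isOpen_lt (by fun_prop) continuous_const,
    Set.mem_iInter₂.2 fun n _ => hb n, fun y hy => ?_⟩
  obtain ⟨s, hs⟩ := RepresentedSpace.surjective y
  refine ⟨fun n => if n < M then b n else s n, fun n => ?_, fun n hn => if_pos hn⟩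
  by_cases hn : n < M
  · have hyn : |(ratOfNat (b n) : ℝ) - y| < (2 : ℝ)⁻¹ ^ n :=
      Set.mem_iInter₂.1 hy n (Finset.mem_range.2 hn)
    simpa only [if_pos hn] using hyn
  · simpa only [if_neg hn] using hs n

/-- Polynomials of degree at most `d` with close coefficients have close values on `[0, 1]`. -/
theorem abs_eval_sub_le {P Q : Polynomial ℝ} {d : ℕ} (hP : P.natDegree ≤ d)
    (hQ : Q.natDegree ≤ d) {ε : ℝ} (h : ∀ i ≤ d, |P.coeff i - Q.coeff i| ≤ ε) (x : unitInterval) :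
    |P.eval (x : ℝ) - Q.eval (x : ℝ)| ≤ (d + 1) * ε := by
  rw [Polynomial.eval_eq_sum_range' (Nat.lt_succ_of_le hP),
    Polynomial.eval_eq_sum_range' (Nat.lt_succ_of_le hQ), ← Finset.sum_sub_distrib]
  refine (Finset.abs_sum_le_sum_abs _ _).trans ?_
  calc _ ≤ ∑ _i ∈ Finset.range d.succ, ε := Finset.sum_le_sum fun i hi => by
        rw [← sub_mul, abs_mul, abs_of_nonneg (pow_nonneg x.2.1 i)]
        have hi' := h i (Nat.lt_succ_iff.1 (Finset.mem_range.1 hi))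
        exact (mul_le_of_le_one_right (abs_nonneg _) (pow_le_one₀ x.2.1 x.2.2)).trans hi'
    _ = (d + 1) * ε := by simp

/-- A prefix of a name of `P` determines the values of `P` on `[0, 1]` up to any precision. -/
theorem exists_prefix_abs_eval_sub_lt {a : Baire} {P : Polynomial ℝ} (ha : IsName a P) {δ : ℝ}
    (hδ : 0 < δ) : ∃ m, ∀ (a' : Baire) (P' : Polynomial ℝ), (∀ n < m, a' n = a n) →
      IsName a' P' → ∀ x : unitInterval, |P.eval (x : ℝ) - P'.eval (x : ℝ)| < δ := by
  set d := a 0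
  have hd1 : (0 : ℝ) < d + 1 := by positivity
  obtain ⟨k, hk⟩ := exists_pow_lt_of_lt_one (show (0 : ℝ) < δ / (2 * (d + 1)) by positivity)
    (by norm_num : (2 : ℝ)⁻¹ < 1)
  -- This prefix contains the degree bound (entry `0`) and the entries `Nat.pair i k + 1` for all `i
  -- ≤ d`.
  refine ⟨Nat.pair d k + 2, fun a' P' haa ha' x => ?_⟩
  have h0 : a' 0 = d := haa 0 (by omega)
  -- Both coefficients lie within `2⁻ᵏ` of the same rational, hence the factor `2` in `ε`.
  refine (abs_eval_sub_le (d := d) (ε := 2 * (2 : ℝ)⁻¹ ^ k) ha.1 (h0 ▸ ha'.1) (fun i hi => ?_)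
    x).trans_lt ?_
  · have h1 := abs_lt.1 (ha.2 i hi k)
    have h2 := abs_lt.1 (ha'.2 i (h0.symm ▸ hi) k)
    have hle : Nat.pair i k ≤ Nat.pair d k := by
      rcases hi.lt_or_eq with h | h
      · exact (Nat.pair_lt_pair_left k h).le
      · exact (congrArg (Nat.pair · k) h).le
    simp only [haa (Nat.pair i k + 1) (by omega)] at h2
    rw [abs_le]
    constructor <;> linarith
  · rw [lt_div_iff₀ (by positivity)] at hk
    linarith

/-- For a nonzero polynomial `P`, finitely many values of `BRoot P` approximate some value of
`BRoot` at every polynomial close to `P`. -/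
theorem exists_finite_BRoot {a : Baire} {P : Polynomial ℝ} (ha : IsName a P) (hP : P ≠ 0) :
    ∃ S : Set unitInterval, S.Finite ∧ S ⊆ BRoot P ∧
      ∀ U : unitInterval → Set unitInterval, (∀ r ∈ S, IsOpen (U r) ∧ r ∈ U r) →
        ∃ m, ∀ (a' : Baire) (P' : Polynomial ℝ), (∀ n < m, a' n = a n) → IsName a' P' →
          ∃ r ∈ S, ∃ x ∈ U r, x ∈ BRoot P' := by
  classical
  let R : Set unitInterval := {r | P.IsRoot (r : ℝ)}
  have hR : R.Finite :=
    (Polynomial.finite_setOfPred_isRoot hP).preimage (f := ((↑) : unitInterval → ℝ))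
      Subtype.val_injective.injOn
  -- `S` must be nonempty even when `P` has no root, in case the nearby polynomial has none either.
  obtain ⟨S, hS, hRS, hSP, r₀, hr₀⟩ :
      ∃ S : Set unitInterval, S.Finite ∧ R ⊆ S ∧ S ⊆ BRoot P ∧ S.Nonempty := by
    rcases R.eq_empty_or_nonempty with h | h
    · refine ⟨{0}, Set.finite_singleton _, by simp [h], fun x _ hex => ?_, by simp⟩
      obtain ⟨y, hy⟩ := hex
      exact absurd (show y ∈ R from hy) (by simp [h])
    · exact ⟨R, hR, subset_rfl, fun x hx _ => hx, h⟩
  refine ⟨S, hS, hSP, fun U hU => ?_⟩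
  -- By compactness, `|P|` is bounded away from `0` off the neighbourhoods of its roots.
  obtain ⟨δ, hδ, hbound⟩ : ∃ δ > 0, ∀ x : unitInterval, (∀ r ∈ R, x ∉ U r) →
      δ ≤ |P.eval (x : ℝ)| := by
    have hcpt : IsCompact (⋃ r ∈ R, U r)ᶜ :=
      (isOpen_biUnion fun r hr => (hU r (hRS hr)).1).isClosed_compl.isCompact
    rcases Set.eq_empty_or_nonempty (⋃ r ∈ R, U r)ᶜ with h | h
    · refine ⟨1, one_pos, fun x hx => ?_⟩
      have : x ∈ (⋃ r ∈ R, U r)ᶜ := by simpa only [Set.mem_compl_iff, Set.mem_iUnion₂, not_exists] using hx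
      simp only [h, Set.mem_empty_iff_false] at this
    · obtain ⟨x₀, hx₀, hmin⟩ := hcpt.exists_isMinOn h
        (f := fun x : unitInterval => |P.eval (x : ℝ)|) (by fun_prop)
      refine ⟨_, abs_pos.2 fun h0 => ?_, fun x hx => hmin (by simpa only [Set.mem_compl_iff, Set.mem_iUnion₂, not_exists] using hx)⟩
      exact hx₀ (Set.mem_biUnion (show x₀ ∈ R from h0) (hU x₀ (hRS h0)).2)
  obtain ⟨m, hm⟩ := exists_prefix_abs_eval_sub_lt ha hδ
  refine ⟨m, fun a' P' haa ha' => ?_⟩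
  by_cases hex : ∃ y : unitInterval, P'.IsRoot (y : ℝ)
  · obtain ⟨y, hy⟩ := hex
    have h1 := hm a' P' haa ha' y
    rw [hy.eq_zero, sub_zero] at h1
    have h2 : ∃ r ∈ R, y ∈ U r := by
      by_contra! h
      exact absurd (hbound y h) (not_le.2 h1)
    obtain ⟨r, hr, hyr⟩ := h2
    exact ⟨r, hRS hr, y, hyr, fun _ => hy⟩
  · exact ⟨r₀, hr₀, r₀, (hU r₀ hr₀).2, fun h => absurd h hex⟩

/-! ### Inputs whose first component is the whole interval -/

/-- Every prefix of a name of `[0, 1]` extends to a name of each closed set. -/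
theorem exists_closeds_name_extension {s : Baire}
    (hs : IsName s (⊤ : TopologicalSpace.Closeds unitInterval))
    (A : TopologicalSpace.Closeds unitInterval) (N : ℕ) :
    ∃ s' : Baire, IsName s' A ∧ ∀ n < N, s' n = s n := by
  obtain ⟨t, ht⟩ := RepresentedSpace.surjective A
  -- A name of `[0,1]` lists only empty intervals, so its prefixes exclude no point.
  have hempty : ∀ n, ratInterval (s n) = ∅ := by
    have h : (((⊤ : TopologicalSpace.Closeds unitInterval) : Set unitInterval))ᶜ =
      ⋃ n, ratInterval (s n) := hs
    exact Set.iUnion_eq_empty.1 (h.symm.trans Set.compl_univ)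
  refine ⟨fun n => if n < N then s n else t (n - N), ?_, fun n hn => if_pos hn⟩
  change (A : Set unitInterval)ᶜ = _
  rw [show (A : Set unitInterval)ᶜ = ⋃ n, ratInterval (t n) from ht]
  ext x
  simp only [Set.mem_iUnion]
  constructor
  · rintro ⟨n, hn⟩
    exact ⟨n + N, by simpa using hn⟩
  · rintro ⟨n, hn⟩
    split_ifs at hn with h
    · simp [hempty] at hn
    · exact ⟨_, hn⟩

theorem isName_pair {X Y : Type*} [RepresentedSpace X] [RepresentedSpace Y] {p q : Baire} {x : X}
    {y : Y} (hp : IsName p x) (hq : IsName q y) : IsName (Baire.pair p q) (x, y) :=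
  ⟨by simpa only [Baire.pair_even] using hp, by simpa only [Baire.pair_odd] using hq⟩

theorem pair_congr {p p' q q' : Baire} {N : ℕ} (hp : ∀ n < N, p' n = p n)
    (hq : ∀ n < N, q' n = q n) : ∀ n < N, Baire.pair p' q' n = Baire.pair p q n := by
  intro n hn
  have : n / 2 < N := by omega
  simp only [Baire.pair, hp _ this, hq _ this]

/-- A reduction of `AoUC × C_2` to `BRoot` sends every name of a pair whose first component is
`[0, 1]` to a name of the zero polynomial. -/
theorem reduction_top_eq_zero {H K : Baire →. Baire} (hH : IsComputable H) (hK : IsComputable K)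
    (hHK : ∀ G : Baire →. Baire, IsRealizer G BRoot →
      IsRealizer (fun p => (H p).bind fun a => (G a).bind fun b => K (Baire.pair p b))
        (AoUC.prod (C 2)))
    {s t : Baire} (hs : IsName s (⊤ : TopologicalSpace.Closeds unitInterval))
    {B : TopologicalSpace.Closeds (Fin 2)} (ht : IsName t B) (hB : (C 2 B).Nonempty)
    {a : Baire} (ha : a ∈ H (Baire.pair s t)) {P : Polynomial ℝ} (haP : IsName a P) : P = 0 := by
  by_contra hP
  obtain ⟨i, hi⟩ := hB
  have hdom : ((⊤ : TopologicalSpace.Closeds unitInterval), B) ∈ (AoUC.prod (C 2)).dom :=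
    ⟨(0, i), ⟨Or.inl rfl, trivial⟩, hi⟩
  obtain ⟨S, hS, hSP, hstab⟩ := exists_finite_BRoot haP hP
  obtain ⟨a₁, ha₁, P₁, haP₁, hsol⟩ :=
    exists_name_of_reduction BRoot_nonempty hHK (isName_pair hs ht) hdom
  obtain rfl := Part.mem_unique ha ha₁
  obtain rfl := RepresentedSpace.unique haP haP₁
  choose b hb using fun r : unitInterval => RepresentedSpace.surjective r
  have hout : ∀ r : unitInterval, ∃ (c : Baire) (x : unitInterval), r ∈ S →
      c ∈ K (Baire.pair (Baire.pair s t) (b r)) ∧ IsName (fun n => c (2 * n)) x := by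
    intro r
    by_cases hr : r ∈ S
    · obtain ⟨c, hc, y, -, hcy⟩ := hsol r (hSP hr) (b r) (hb r)
      exact ⟨c, y.1, fun _ => ⟨hc, hcy.1⟩⟩
    · exact ⟨b r, r, fun h => absurd h hr⟩
  choose c x hcx using hout
  have : Infinite unitInterval := (Set.Icc_infinite (zero_lt_one' ℝ)).to_subtype
  obtain ⟨y, hy⟩ : ∃ y, y ∉ x '' S := (hS.image x).exists_notMem
  -- Near each `r ∈ S` the output stays close to `x r`, hence differs from `y`.
  have hloc : ∀ r : unitInterval, ∃ (N : ℕ) (U : Set unitInterval), r ∈ S →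
      IsOpen U ∧ r ∈ U ∧ ∀ s' : Baire, (∀ n < N, s' n = s n) →
        ∀ z ∈ U, ∃ b', IsName b' z ∧ ∀ c' ∈ K (Baire.pair (Baire.pair s' t) b'),
          ¬ IsName (fun n => c' (2 * n)) y := by
    intro r
    by_cases hr : r ∈ S
    swap
    · exact ⟨0, ∅, fun h => absurd h hr⟩
    obtain ⟨hc, hx⟩ := hcx r hr
    have hne : (0 : ℝ) < |(x r : ℝ) - y| := by
      refine abs_pos.2 (sub_ne_zero.2 fun h => hy ⟨r, hr, Subtype.ext h⟩)
    obtain ⟨k, hk⟩ := exists_pow_lt_of_lt_one (half_pos hne) (by norm_num : (2 : ℝ)⁻¹ < 1)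
    -- Output entry `2 * k` is the `k`-th approximation in the first component.
    obtain ⟨N, hN⟩ := hK.exists_modulus hc (2 * k + 1)
    obtain ⟨U, hU, hrU, hext⟩ := exists_isOpen_name_extension (hb r) N
    refine ⟨N, U, fun _ => ⟨hU, hrU, fun s' hs' z hz => ?_⟩⟩
    obtain ⟨b', hb', hbb⟩ := hext z hz
    refine ⟨b', hb', fun c' hc' hcy => ?_⟩
    have heq : c' (2 * k) = c r (2 * k) :=
      hN _ c' (pair_congr (pair_congr hs' fun _ _ => rfl) hbb) hc' _ (by omega)
    have h1 := hcy k
    have h2 : |(ratOfNat (c r (2 * k)) : ℝ) - x r| < (2 : ℝ)⁻¹ ^ k := hx k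
    simp only [heq] at h1
    have h3 := abs_sub_le (x r : ℝ) (ratOfNat (c r (2 * k))) y
    rw [abs_sub_comm (x r : ℝ) (ratOfNat (c r (2 * k)))] at h3
    linarith
  choose N U hNU using hloc
  obtain ⟨m, hm⟩ := hstab U fun r hr => ⟨(hNU r hr).1, (hNU r hr).2.1⟩
  obtain ⟨N₀, hN₀⟩ := hH.exists_modulus ha m
  obtain ⟨N₁, hN₁⟩ := (hS.image N).bddAbove
  let A : TopologicalSpace.Closeds unitInterval := ⟨{y}, isClosed_singleton⟩
  -- `N₀` keeps the new polynomial close to `P`; `N₁` keeps the output of `K` away from `y` near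
  -- every `r ∈ S`.
  obtain ⟨s', hs'A, hs'⟩ := exists_closeds_name_extension hs A (max N₀ N₁)
  have hdom' : (A, B) ∈ (AoUC.prod (C 2)).dom := ⟨(y, i), ⟨Or.inr ⟨y, rfl⟩, rfl⟩, hi⟩
  obtain ⟨a', ha', P', haP', hsol'⟩ :=
    exists_name_of_reduction BRoot_nonempty hHK (isName_pair hs'A ht) hdom'
  obtain ⟨r, hr, z, hz, hzP⟩ := hm a' P' (hN₀ _ a' (pair_congr
    (fun n hn => hs' n (hn.trans_le (le_max_left _ _))) fun _ _ => rfl) ha') haP'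
  obtain ⟨b', hb', hno⟩ := (hNU r hr).2.2 s' (fun n hn => hs' n (hn.trans_le
    ((hN₁ ⟨r, hr, rfl⟩).trans (le_max_right _ _)))) z hz
  obtain ⟨c', hc', ⟨v, j⟩, hvj, hcv⟩ := hsol' z hzP b' hb'
  have hvy : v = y := hvj.1.2
  subst hvy
  exact hno c' hc' hcv.1

end Weihrauch

/-! ### Discontinuity of `C_2` -/

open Weihrauch RepresentedSpace in
theorem proposition11 :
    ¬ Weihrauch.Reducible (Weihrauch.AoUC.prod (Weihrauch.C 2)) Weihrauch.BRoot := by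
  rintro ⟨H, K, hH, hK, hHK⟩
  obtain ⟨s, hs⟩ := RepresentedSpace.surjective (⊤ : TopologicalSpace.Closeds unitInterval)
  obtain ⟨b, hb⟩ := RepresentedSpace.surjective (0 : unitInterval)
  have hsol : ∀ (t : Baire) (B : TopologicalSpace.Closeds (Fin 2)), IsName t B →
      (C 2 B).Nonempty → ∃ c ∈ K (Baire.pair (Baire.pair s t) b), ∃ i ∈ B, c 1 = (i : ℕ) := by
    rintro t B ht ⟨i, hi⟩
    obtain ⟨a, ha, P, haP, h⟩ := exists_name_of_reduction BRoot_nonempty hHK (isName_pair hs ht)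
      ⟨(0, i), ⟨Or.inl rfl, trivial⟩, hi⟩
    have hP : P = 0 := reduction_top_eq_zero hH hK hHK hs ht ⟨i, hi⟩ ha haP
    obtain ⟨c, hc, ⟨v, j⟩, hvj, hcv⟩ := h 0 (fun _ => by simp [hP]) b hb
    exact ⟨c, hc, j, hvj.2, hcv.2⟩
  have htop : IsName (fun _ => 0 : Baire) (⊤ : TopologicalSpace.Closeds (Fin 2)) := by
    change ((⊤ : TopologicalSpace.Closeds (Fin 2)) : Set (Fin 2))ᶜ = _
    ext j
    simp
  obtain ⟨c, hc, i, -, hci⟩ := hsol _ _ htop ⟨0, trivial⟩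
  -- Entry `1` of the output is the first entry of its second component, which is the answer to
  -- `C_2`.
  obtain ⟨N, hN⟩ := hK.exists_modulus hc 2
  -- The answer `i` is fixed by `N` entries that remove nothing; it is removed right after them.
  let B : TopologicalSpace.Closeds (Fin 2) := ⟨{i}ᶜ, isClosed_discrete _⟩
  have hB : IsName (fun n => if n < N then 0 else (i : ℕ) + 1 : Baire) B := by
    change (({i}ᶜ : Set (Fin 2)))ᶜ = _
    ext j
    rw [compl_compl, Set.mem_singleton_iff, Set.mem_ofPred_eq]
    constructor
    · rintro rfl
      exact ⟨N, if_neg (lt_irrefl N)⟩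
    · rintro ⟨n, hn⟩
      dsimp only at hn
      split_ifs at hn
      exact Fin.ext (by omega)
  obtain ⟨j₀, hj₀⟩ := exists_ne i
  obtain ⟨c', hc', j, hj, hcj⟩ := hsol _ B hB ⟨j₀, hj₀⟩
  have heq : c' 1 = c 1 := hN _ c' (pair_congr (pair_congr (fun _ _ => rfl) fun n hn => if_pos hn)
    fun _ _ => rfl) hc' 1 one_lt_two
  exact hj (Fin.ext (by omega : (j : ℕ) = i))
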